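/- Let $G$ be a (discrete) group with identity $e$, let $\lambda$ be the left-regular representation of $G$ on $\ell^2(G)$, given by $(\lambda(s)f)(x)=f(s^{-1}x)$, and let $C^*_\lambda(G)$ be the reduced group $C^*$-algebra, i.e. the norm closure in $B(\ell^2(G))$ of the $*$-subalgebra generated by $\{\lambda(s) : s\in G\}$. A tracial state on $C^*_\lambda(G)$ is a positive linear functional $\tau$ with $\tau(1)=1$ and $\tau(ab)=\tau(ba)$ for all $a,b\in C^*_\lambda(G)$. Then $C^*_\lambda(G)$ has a unique tracial state if and only if, for every $t\in G\setminus\{e\}$, $0$ belongs to the norm closure of the convex hull of $\{\lambda(sts^{-1}) : s\in G\}$ in $C^*_\lambda(G)$. -/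

import Mathlib

open scoped lp

noncomputable section

namespace ReducedGroup

/-- Left translation by a group element preserves square-summability. -/
theorem memlp_translate {G : Type*} [Group G] (s : G) (f : ℓ²(G, ℂ)) :
    Memℓp (fun x : G => f (s⁻¹ * x)) 2 := by
  have h2 : (0 : ℝ) < (2 : ENNReal).toReal := by norm_num
  exact memℓp_gen
    ((Equiv.mulLeft s⁻¹).summable_iff.mpr ((lp.memℓp f).summable h2))

/-- The unitary operator `λ(s)` on `ℓ²(G)`, given by `(λ(s) f)(x) = f (s⁻¹ x)`. -/
def translate {G : Type*} [Group G] (s : G) : ℓ²(G, ℂ) ≃ₗᵢ[ℂ] ℓ²(G, ℂ) where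
  toFun f := ⟨fun x => f (s⁻¹ * x), memlp_translate s f⟩
  invFun f := ⟨fun x => f (s * x), by
    have h := memlp_translate s⁻¹ f
    rwa [inv_inv] at h⟩
  map_add' _ _ := rfl
  map_smul' _ _ := rfl
  left_inv f := by
    ext x
    change f (s⁻¹ * (s * x)) = f x
    simp
  right_inv f := by
    ext x
    change f (s * (s⁻¹ * x)) = f x
    simp
  norm_map' f := by
    have h2 : (0 : ℝ) < (2 : ENNReal).toReal := by norm_num
    rw [lp.norm_eq_tsum_rpow h2, lp.norm_eq_tsum_rpow h2]
    congr 1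
    exact (Equiv.mulLeft s⁻¹).tsum_eq (fun x => ‖f x‖ ^ (2 : ENNReal).toReal)

@[simp]
theorem translate_apply {G : Type*} [Group G] (s : G) (f : ℓ²(G, ℂ)) (x : G) :
    translate s f x = f (s⁻¹ * x) := rfl

/-- The left-regular representation `λ` of the (discrete) group `G` on `ℓ²(G)`. -/
def leftRegular (G : Type*) [Group G] : G →* unitary (ℓ²(G, ℂ) →L[ℂ] ℓ²(G, ℂ)) where
  toFun s := Unitary.linearIsometryEquiv.symm (translate s)
  map_one' := by
    rw [MulEquiv.map_eq_one_iff]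
    ext f x
    simp
  map_mul' s t := by
    rw [← map_mul]
    congr 1
    ext f x
    simp [mul_assoc]

/-- The reduced group C⋆-algebra `C*_λ(G)`: the norm closure, in the bounded operators on `ℓ²(G)`,
of the ⋆-subalgebra generated by the operators `λ(s)`, `s ∈ G`. -/
def reducedCStar (G : Type*) [Group G] : StarSubalgebra ℂ (ℓ²(G, ℂ) →L[ℂ] ℓ²(G, ℂ)) :=
  (StarAlgebra.adjoin ℂ
    (Set.range fun s : G => (leftRegular G s : ℓ²(G, ℂ) →L[ℂ] ℓ²(G, ℂ)))).topologicalClosure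

/-- The operator `λ(s)`, as an element of `C*_λ(G)`. -/
def lam {G : Type*} [Group G] (s : G) : reducedCStar G :=
  ⟨leftRegular G s, StarSubalgebra.le_topologicalClosure _
    (StarAlgebra.subset_adjoin ℂ _ (Set.mem_range_self s))⟩

/-- A tracial state on a unital C⋆-algebra: a (bounded) linear functional that is positive,
unital and satisfies `τ (a b) = τ (b a)`. Positivity says that `τ (a* a)` is a nonnegative
real number for every `a`. -/
structure IsTracialState {A : Type*} [Ring A] [StarRing A] [Algebra ℂ A]
    [TopologicalSpace A] (τ : A →L[ℂ] ℂ) : Prop where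
  nonneg : ∀ a : A, 0 ≤ (τ (star a * a)).re ∧ (τ (star a * a)).im = 0
  map_one : τ 1 = 1
  trace : ∀ a b : A, τ (a * b) = τ (b * a)

end ReducedGroup

end

noncomputable section

namespace ReducedGroup

open Filter Topology

/-! ### Tracial states and almost invariant vectors. -/

section Trace

variable {G : Type*} [Group G]

/-! If 0 is a norm limit of averages of conjugates of `lam t`, every tracial state, being constant
on those averages, vanishes at `lam t`. The translations span a dense subspace, so only the
canonical trace is left.

Conversely, let the tracial state be unique. The means on bounded functions on G form a compact
convex semigroup under convolution; take a minimal closed convex left ideal K in it. Its fixator N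
is normal and every element of K is an N-invariant mean, so Day's argument yields almost invariant
vectors in ℓ²(N) (`hasAlmostInvariantVectors_of_mean`), and the indicator of N extends to a tracial
state (`exists_isTracialState`). Uniqueness forces N to be trivial.

Hence t ≠ e moves an extreme point of K. From this `exists_displaced_set` extracts a set A, disjoint
from tA, for which averages of translates of the indicator come uniformly close to 1. As λ(s⁻¹ts)
carries ℓ²(s⁻¹A) into its orthogonal complement, averaging these conjugates with the same weights
gives operators of small norm (`zero_mem_closure_of_displaced`). -/

@[simp]
theorem lam_apply (s : G) (f : ℓ²(G, ℂ)) (x : G) :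
    (lam s : ℓ²(G, ℂ) →L[ℂ] ℓ²(G, ℂ)) f x = f (s⁻¹ * x) := rfl

theorem lam_one : lam (1 : G) = 1 := by
  apply Subtype.ext
  simp [lam]

theorem lam_mul (s t : G) : lam (s * t) = lam s * lam t := by
  apply Subtype.ext
  simp [lam]

/-- The span of the translation operators is dense in the reduced group C⋆-algebra. -/
theorem dense_span_range_lam :
    Dense (Submodule.span ℂ (Set.range (lam : G → reducedCStar G)) : Set (reducedCStar G)) := by
  intro a
  rw [closure_subtype]
  have ha : (a : ℓ²(G, ℂ) →L[ℂ] ℓ²(G, ℂ)) ∈ closure ((StarAlgebra.adjoin ℂ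
      (Set.range fun s : G => (leftRegular G s : ℓ²(G, ℂ) →L[ℂ] ℓ²(G, ℂ)))) :
      Set (ℓ²(G, ℂ) →L[ℂ] ℓ²(G, ℂ))) := a.2
  refine closure_mono ?_ ha
  intro b hb
  have hb' : b ∈ Subalgebra.toSubmodule (StarAlgebra.adjoin ℂ
      (Set.range fun s : G =>
        (leftRegular G s : ℓ²(G, ℂ) →L[ℂ] ℓ²(G, ℂ)))).toSubalgebra := hb
  rw [StarAlgebra.adjoin_eq_span] at hb'
  have hle : Submodule.span ℂ ((Submonoid.closure
      ((Set.range fun s : G => (leftRegular G s : ℓ²(G, ℂ) →L[ℂ] ℓ²(G, ℂ))) ∪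
        star (Set.range fun s : G => (leftRegular G s : ℓ²(G, ℂ) →L[ℂ] ℓ²(G, ℂ)))) :
        Set (ℓ²(G, ℂ) →L[ℂ] ℓ²(G, ℂ)))) ≤
      (Submodule.span ℂ (Set.range (lam : G → reducedCStar G))).map
        (reducedCStar G).subtype.toLinearMap := by
    rw [Submodule.span_le]
    intro c hc
    have : ∃ s : G, (leftRegular G s : ℓ²(G, ℂ) →L[ℂ] ℓ²(G, ℂ)) = c := by
      induction hc using Submonoid.closure_induction with
      | mem x hx =>
        rcases hx with ⟨s, hs⟩ | ⟨s, hs⟩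
        · exact ⟨s, hs⟩
        · refine ⟨s⁻¹, ?_⟩
          rw [← star_star x, ← hs, map_inv]
          rfl
      | one => exact ⟨1, by simp⟩
      | mul x y _ _ hx hy =>
        obtain ⟨s, rfl⟩ := hx
        obtain ⟨t, rfl⟩ := hy
        exact ⟨s * t, by simp⟩
    obtain ⟨s, rfl⟩ := this
    exact ⟨lam s, Submodule.subset_span ⟨s, rfl⟩, rfl⟩
  obtain ⟨c, hc, rfl⟩ := hle hb'
  exact ⟨c, hc, rfl⟩

theorem functional_ext {φ ψ : reducedCStar G →L[ℂ] ℂ} (h : ∀ s, φ (lam s) = ψ (lam s)) :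
    φ = ψ := by
  refine DFunLike.coe_injective
    (Continuous.ext_on dense_span_range_lam φ.continuous ψ.continuous fun a ha => ?_)
  induction ha using Submodule.span_induction with
  | mem a ha =>
    obtain ⟨s, rfl⟩ := ha
    exact h s
  | zero => rw [map_zero, map_zero]
  | add a b _ _ ha hb => rw [map_add, map_add, ha, hb]
  | smul c a _ ha => rw [map_smul, map_smul, ha]

/-- A functional on the reduced C⋆-algebra which restricts to a class function on the group is
tracial. -/
theorem trace_of_class_function {τ : reducedCStar G →L[ℂ] ℂ}
    (h : ∀ s t, τ (lam (s * t)) = τ (lam (t * s))) (a b : reducedCStar G) :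
    τ (a * b) = τ (b * a) := by
  have h₁ (s : G) : τ.comp (ContinuousLinearMap.mul ℂ (reducedCStar G) (lam s)) =
      τ.comp ((ContinuousLinearMap.mul ℂ (reducedCStar G)).flip (lam s)) :=
    functional_ext fun t => by simpa [lam_mul] using h s t
  have h₂ : τ.comp ((ContinuousLinearMap.mul ℂ (reducedCStar G)).flip b) =
      τ.comp (ContinuousLinearMap.mul ℂ (reducedCStar G) b) :=
    functional_ext fun s => by simpa using DFunLike.congr_fun (h₁ s) b
  simpa using DFunLike.congr_fun h₂ a

/-- A subgroup `N` such that `ℓ²(N) ⊆ ℓ²(G)` contains almost `N`-invariant unit vectors. -/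
def HasAlmostInvariantVectors (N : Subgroup G) : Prop :=
  ∀ F : Finset G, (∀ n ∈ F, n ∈ N) → ∀ ε : ℝ, 0 < ε → ∃ ξ : ℓ²(G, ℂ), ‖ξ‖ = 1 ∧
    (∀ x, x ∉ N → ξ x = 0) ∧
    ∀ n ∈ F, ‖(leftRegular G n : ℓ²(G, ℂ) →L[ℂ] ℓ²(G, ℂ)) ξ - ξ‖ ≤ ε

theorem hasAlmostInvariantVectors_bot : HasAlmostInvariantVectors (⊥ : Subgroup G) := by
  classical
  intro F hF ε hε
  refine ⟨lp.single 2 1 1, by simp [lp.norm_single], fun x hx => ?_, fun n hn => ?_⟩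
  · rw [Subgroup.mem_bot] at hx
    simp [lp.single_apply, hx]
  · have : n = 1 := Subgroup.mem_bot.1 (hF n hn)
    subst this
    simpa using hε.le

/-- The vector functional `T ↦ ⟪ξ, T ξ⟫`. -/
def vectorState {G : Type*} (ξ : ℓ²(G, ℂ)) : (ℓ²(G, ℂ) →L[ℂ] ℓ²(G, ℂ)) →L[ℂ] ℂ :=
  (innerSL ℂ ξ).comp (ContinuousLinearMap.apply ℂ (ℓ²(G, ℂ)) ξ)

theorem vectorState_apply {G : Type*} (ξ : ℓ²(G, ℂ)) (T : ℓ²(G, ℂ) →L[ℂ] ℓ²(G, ℂ)) :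
    vectorState ξ T = inner ℂ ξ (T ξ) := rfl

theorem norm_vectorState_le {G : Type*} {ξ : ℓ²(G, ℂ)} (hξ : ‖ξ‖ = 1) : ‖vectorState ξ‖ ≤ 1 := by
  refine ContinuousLinearMap.opNorm_le_bound _ zero_le_one fun T => ?_
  rw [vectorState_apply]
  calc ‖inner ℂ ξ (T ξ)‖ ≤ ‖ξ‖ * ‖T ξ‖ := norm_inner_le_norm _ _
    _ ≤ ‖ξ‖ * (‖T‖ * ‖ξ‖) := by gcongr; exact T.le_opNorm ξ
    _ = 1 * ‖T‖ := by rw [hξ]; ring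

/-- A limit of vector states at increasingly invariant vectors. Off N, disjointness of supports
makes each term vanish; normality makes the indicator of N a class function, which gives the trace
property. -/
theorem exists_isTracialState {N : Subgroup G} [N.Normal] (hN : HasAlmostInvariantVectors N) :
    ∃ τ : reducedCStar G →L[ℂ] ℂ, IsTracialState τ ∧
      (∀ s ∈ N, τ (lam s) = 1) ∧ ∀ s ∉ N, τ (lam s) = 0 := by
  classical
  have hpos (k : ℕ) : (0 : ℝ) < 1 / (k + 1) := Nat.one_div_pos_of_nat
  -- The index records a finite subset of N and a tolerance 1/(k+1); an ultrafilter finer than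
  -- `atTop` improves both at once, and Banach–Alaoglu provides the limit.
  choose ξ hξ₁ hξ₂ hξ₃ using fun i : Finset N × ℕ => hN (i.1.image Subtype.val)
    (fun n hn => by
      obtain ⟨m, -, rfl⟩ := Finset.mem_image.1 hn
      exact m.2) (1 / (i.2 + 1)) (hpos i.2)
  let U : Ultrafilter (Finset N × ℕ) := Ultrafilter.of atTop
  have hU : (U : Filter (Finset N × ℕ)) ≤ atTop := Ultrafilter.of_le _
  let w : Finset N × ℕ → WeakDual ℂ (ℓ²(G, ℂ) →L[ℂ] ℓ²(G, ℂ)) :=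
    fun i => StrongDual.toWeakDual (vectorState (ξ i))
  obtain ⟨φ, -, hφ⟩ := (WeakDual.isCompact_closedBall (𝕜 := ℂ)
    (0 : StrongDual ℂ (ℓ²(G, ℂ) →L[ℂ] ℓ²(G, ℂ))) 1).ultrafilter_le_nhds (U.map w) (by
      rw [Filter.le_principal_iff]
      refine Filter.mem_map.2 (Filter.univ_mem' fun i => ?_)
      simpa [w] using norm_vectorState_le (hξ₁ i))
  have hlim (T : ℓ²(G, ℂ) →L[ℂ] ℓ²(G, ℂ)) :
      Tendsto (fun i => inner ℂ (ξ i) (T (ξ i))) U (𝓝 (φ T)) := by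
    have h : Tendsto w U (𝓝 φ) := hφ
    exact ((WeakDual.eval_continuous T).tendsto φ).comp h
  let φ' : (ℓ²(G, ℂ) →L[ℂ] ℓ²(G, ℂ)) →L[ℂ] ℂ := WeakDual.toStrongDual φ
  let τ : reducedCStar G →L[ℂ] ℂ := φ'.comp
    ((reducedCStar G).toSubalgebra.toSubmodule.subtypeL)
  have hτ (a : reducedCStar G) : Tendsto (fun i =>
      inner ℂ (ξ i) ((a : ℓ²(G, ℂ) →L[ℂ] ℓ²(G, ℂ)) (ξ i))) U (𝓝 (τ a)) := hlim a
  have hin : ∀ s ∈ N, τ (lam s) = 1 := by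
    intro s hs
    refine tendsto_nhds_unique (hτ (lam s)) ?_
    rw [tendsto_iff_norm_sub_tendsto_zero]
    have hz : Tendsto (fun i : Finset N × ℕ => 1 / ((i.2 : ℝ) + 1)) U (𝓝 0) := by
      refine Tendsto.mono_left ?_ hU
      rw [← prod_atTop_atTop_eq]
      exact tendsto_one_div_add_atTop_nhds_zero_nat.comp tendsto_snd
    refine squeeze_zero' (Eventually.of_forall fun _ => norm_nonneg _) ?_ hz
    have hev : ∀ᶠ i in (U : Filter (Finset N × ℕ)), (({⟨s, hs⟩} : Finset N), 0) ≤ i :=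
      hU (eventually_ge_atTop _)
    filter_upwards [hev] with i hi
    have hmem : s ∈ i.1.image Subtype.val :=
      Finset.mem_image.2 ⟨⟨s, hs⟩, hi.1 (Finset.mem_singleton_self _), rfl⟩
    have h1 : inner ℂ (ξ i) (ξ i) = (1 : ℂ) := by
      rw [inner_self_eq_norm_sq_to_K, hξ₁ i]; simp
    rw [← h1, ← inner_sub_right]
    calc _ ≤ ‖ξ i‖ * ‖(lam s : ℓ²(G, ℂ) →L[ℂ] ℓ²(G, ℂ)) (ξ i) - ξ i‖ := norm_inner_le_norm _ _
      _ ≤ 1 * (1 / ((i.2 : ℝ) + 1)) := by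
        rw [hξ₁ i]
        gcongr
        exact hξ₃ i s hmem
      _ = _ := one_mul _
  have hout : ∀ s ∉ N, τ (lam s) = 0 := by
    intro s hs
    refine tendsto_nhds_unique (hτ (lam s)) ?_
    have : ∀ i, inner ℂ (ξ i) ((lam s : ℓ²(G, ℂ) →L[ℂ] ℓ²(G, ℂ)) (ξ i)) = 0 := by
      intro i
      rw [lp.inner_eq_tsum]
      refine (tsum_congr fun x => ?_).trans tsum_zero
      rw [lam_apply]
      by_cases hx : x ∈ N
      · rw [hξ₂ i (s⁻¹ * x) fun h => hs (by simpa using (N.mul_mem_cancel_right hx).1 h)]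
        simp
      · rw [hξ₂ i x hx]
        simp
    simp only [this]
    exact tendsto_const_nhds
  refine ⟨τ, ⟨fun a => ?_, ?_, trace_of_class_function fun s t => ?_⟩, hin, hout⟩
  · have h : ∀ i, inner ℂ (ξ i) (((star a * a : reducedCStar G) :
        ℓ²(G, ℂ) →L[ℂ] ℓ²(G, ℂ)) (ξ i)) =
          ((‖(a : ℓ²(G, ℂ) →L[ℂ] ℓ²(G, ℂ)) (ξ i)‖ ^ 2 : ℝ) : ℂ) := by
      intro i
      have : ((star a * a : reducedCStar G) : ℓ²(G, ℂ) →L[ℂ] ℓ²(G, ℂ)) (ξ i) =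
        ContinuousLinearMap.adjoint (a : ℓ²(G, ℂ) →L[ℂ] ℓ²(G, ℂ))
          ((a : ℓ²(G, ℂ) →L[ℂ] ℓ²(G, ℂ)) (ξ i)) := rfl
      rw [this, ContinuousLinearMap.adjoint_inner_right, inner_self_eq_norm_sq_to_K]
      simp
    have hlim' := hτ (star a * a)
    simp only [h] at hlim'
    refine ⟨ge_of_tendsto ((Complex.continuous_re.tendsto _).comp hlim')
      (Eventually.of_forall fun i => ?_),
      tendsto_nhds_unique ((Complex.continuous_im.tendsto _).comp hlim') ?_⟩
    · simp only [Function.comp_apply, Complex.ofReal_re]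
      positivity
    · simp only [Function.comp_def, Complex.ofReal_im]
      exact tendsto_const_nhds
  · rw [← lam_one]
    exact hin 1 N.one_mem
  · by_cases hst : s * t ∈ N
    · rw [hin _ hst, hin _ (Subgroup.Normal.mem_comm inferInstance hst)]
    · rw [hout _ hst, hout _ fun h => hst (Subgroup.Normal.mem_comm inferInstance h)]

/-- A tracial state vanishes at `λ(t)` when `0` is a norm limit of averages of conjugates. -/
theorem IsTracialState.apply_lam_eq_zero {τ : reducedCStar G →L[ℂ] ℂ} (hτ : IsTracialState τ)
    {t : G} (ht : (0 : reducedCStar G) ∈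
      closure (convexHull ℝ (Set.range fun s : G => lam (s * t * s⁻¹)))) : τ (lam t) = 0 := by
  have hconj (s : G) : τ (lam (s * t * s⁻¹)) = τ (lam t) := by
    rw [lam_mul, hτ.trace, ← lam_mul]
    simp
  have hconv : Convex ℝ (τ ⁻¹' {τ (lam t)}) :=
    (convex_singleton (𝕜 := ℝ) (τ (lam t))).is_linear_preimage
      ⟨map_add τ, fun c x => by simp⟩
  have h : closure (convexHull ℝ (Set.range fun s : G => lam (s * t * s⁻¹))) ⊆
      τ ⁻¹' {τ (lam t)} := by
    refine closure_minimal (convexHull_min ?_ hconv) (isClosed_singleton.preimage τ.continuous)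
    rintro _ ⟨s, rfl⟩
    exact hconj s
  have := h ht
  simpa using (this : τ 0 = τ (lam t)).symm

theorem existsUnique_isTracialState
    (h : ∀ t : G, t ≠ 1 → (0 : reducedCStar G) ∈
      closure (convexHull ℝ (Set.range fun s : G => lam (s * t * s⁻¹)))) :
    ∃! τ : reducedCStar G →L[ℂ] ℂ, IsTracialState τ := by
  obtain ⟨τ, hτ, -⟩ := exists_isTracialState (hasAlmostInvariantVectors_bot (G := G))
  refine ⟨τ, hτ, fun σ hσ => functional_ext fun s => ?_⟩
  by_cases hs : s = 1
  · rw [hs, lam_one, hσ.map_one, hτ.map_one]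
  · rw [hσ.apply_lam_eq_zero (h s hs), hτ.apply_lam_eq_zero (h s hs)]

/-- The traces built from N and from `⊥` must coincide, yet differ on N outside the identity. -/
theorem eq_bot_of_hasAlmostInvariantVectors
    (h : ∃! τ : reducedCStar G →L[ℂ] ℂ, IsTracialState τ) {N : Subgroup G} [N.Normal]
    (hN : HasAlmostInvariantVectors N) : N = ⊥ := by
  obtain ⟨τ, hτ, hin, -⟩ := exists_isTracialState hN
  obtain ⟨σ, hσ, -, hout⟩ := exists_isTracialState (hasAlmostInvariantVectors_bot (G := G))
  rw [Subgroup.eq_bot_iff_forall]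
  intro s hs
  by_contra hne
  have h₁ := hout s (by rwa [Subgroup.mem_bot])
  rw [h.unique hσ hτ, hin s hs] at h₁
  exact one_ne_zero h₁

end Trace

/-! ### Means on bounded functions. -/

section Mean

/-- Bounded real functions on `G`, with the supremum norm. -/
abbrev BddFun (G : Type*) : Type _ := lp (fun _ : G => ℝ) ⊤

/-- The bounded function given by a function with an explicit bound. -/
def BddFun.mk {G : Type*} (f : G → ℝ) (C : ℝ) (h : ∀ x, |f x| ≤ C) : BddFun G :=
  ⟨f, memℓp_infty ⟨C, by rintro _ ⟨x, rfl⟩; exact h x⟩⟩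

@[simp]
theorem BddFun.mk_apply {G : Type*} (f : G → ℝ) (C : ℝ) (h : ∀ x, |f x| ≤ C) (x : G) :
    BddFun.mk f C h x = f x := rfl

theorem BddFun.abs_apply_le {G : Type*} (f : BddFun G) (x : G) : |f x| ≤ ‖f‖ :=
  lp.norm_apply_le_norm ENNReal.top_ne_zero f x

@[simp]
theorem BddFun.one_apply {G : Type*} (x : G) : (1 : BddFun G) x = 1 := by
  rw [lp.infty_coeFn_one]; rfl

@[simp]
theorem BddFun.mul_apply {G : Type*} (f g : BddFun G) (x : G) : (f * g) x = f x * g x := by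
  rw [lp.infty_coeFn_mul]; rfl

@[simp]
theorem BddFun.add_apply {G : Type*} (f g : BddFun G) (x : G) : (f + g) x = f x + g x := rfl

@[simp]
theorem BddFun.sub_apply {G : Type*} (f g : BddFun G) (x : G) : (f - g) x = f x - g x := rfl

@[simp]
theorem BddFun.neg_apply {G : Type*} (f : BddFun G) (x : G) : (-f) x = -f x := rfl

@[simp]
theorem BddFun.smul_apply {G : Type*} (c : ℝ) (f : BddFun G) (x : G) : (c • f) x = c * f x := rfl

/-- The indicator function of a set. -/
def BddFun.ind {G : Type*} (A : Set G) : BddFun G :=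
  BddFun.mk (A.indicator 1) 1 fun x => by
    by_cases hx : x ∈ A <;> simp [hx]

theorem BddFun.ind_apply {G : Type*} (A : Set G) (x : G) :
    BddFun.ind A x = A.indicator (1 : G → ℝ) x := rfl

/-- A mean: a finitely additive probability measure, as a functional on bounded functions. -/
structure IsMean {G : Type*} (m : BddFun G → ℝ) : Prop where
  add : ∀ f g, m (f + g) = m f + m g
  smul : ∀ (c : ℝ) f, m (c • f) = c * m f
  nonneg : ∀ f, (∀ x, 0 ≤ f x) → 0 ≤ m f
  one : m 1 = 1

namespace IsMean

variable {G : Type*} {m : BddFun G → ℝ}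

theorem neg (hm : IsMean m) (f : BddFun G) : m (-f) = -m f := by
  rw [← neg_one_smul ℝ f, hm.smul]; ring

theorem sub (hm : IsMean m) (f g : BddFun G) : m (f - g) = m f - m g := by
  rw [sub_eq_add_neg, hm.add, hm.neg]; ring

theorem mono (hm : IsMean m) {f g : BddFun G} (h : ∀ x, f x ≤ g x) : m f ≤ m g := by
  have := hm.nonneg (g - f) fun x => by simpa using h x
  rw [hm.sub] at this
  linarith

theorem const (hm : IsMean m) (c : ℝ) : m (c • 1) = c := by
  rw [hm.smul, hm.one, mul_one]

theorem le_of_forall_le (hm : IsMean m) {f : BddFun G} {c : ℝ} (h : ∀ x, f x ≤ c) : m f ≤ c := by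
  rw [← hm.const c]
  exact hm.mono fun x => by simpa using h x

theorem le_of_forall_ge (hm : IsMean m) {f : BddFun G} {c : ℝ} (h : ∀ x, c ≤ f x) : c ≤ m f := by
  rw [← hm.const c]
  exact hm.mono fun x => by simpa using h x

theorem abs_le (hm : IsMean m) (f : BddFun G) : |m f| ≤ ‖f‖ :=
  _root_.abs_le.2 ⟨hm.le_of_forall_ge fun x => (_root_.abs_le.1 (f.abs_apply_le x)).1,
    hm.le_of_forall_le fun x => (_root_.abs_le.1 (f.abs_apply_le x)).2⟩

/-- Point evaluations are means. -/
theorem eval (x : G) : IsMean fun f : BddFun G => f x :=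
  ⟨fun _ _ => rfl, fun _ _ => rfl, fun _ h => h x, BddFun.one_apply x⟩

/-- A mean may be conditioned by a weight of positive mean. -/
theorem weighted (hm : IsMean m) {w : BddFun G} (hw : ∀ x, 0 ≤ w x) (hpos : 0 < m w) :
    IsMean fun f => (m w)⁻¹ * m (w * f) where
  add f g := by rw [mul_add, hm.add]; ring
  smul c f := by rw [mul_smul_comm, hm.smul]; ring
  nonneg f hf := mul_nonneg (inv_nonneg.2 hpos.le)
    (hm.nonneg _ fun x => by simpa using mul_nonneg (hw x) (hf x))
  one := by rw [mul_one, inv_mul_cancel₀ hpos.ne']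

theorem convex_setOf : Convex ℝ {m : BddFun G → ℝ | IsMean m} := by
  intro m hm k hk a b ha hb hab
  have hm : IsMean m := hm
  have hk : IsMean k := hk
  refine ⟨fun f g => ?_, fun c f => ?_, fun f hf => ?_, ?_⟩ <;>
    simp only [Pi.add_apply, Pi.smul_apply, smul_eq_mul]
  · rw [hm.add, hk.add]; ring
  · rw [hm.smul, hk.smul]; ring
  · exact add_nonneg (mul_nonneg ha (hm.nonneg f hf)) (mul_nonneg hb (hk.nonneg f hf))
  · rw [hm.one, hk.one]; linarith

theorem isClosed_setOf : IsClosed {m : BddFun G → ℝ | IsMean m} := by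
  have : {m : BddFun G → ℝ | IsMean m} =
      (⋂ f, ⋂ g, {m | m (f + g) = m f + m g}) ∩ (⋂ c : ℝ, ⋂ f, {m | m (c • f) = c * m f}) ∩
      (⋂ f : BddFun G, ⋂ _ : ∀ x, 0 ≤ f x, {m | 0 ≤ m f}) ∩ {m | m 1 = 1} := by
    ext m
    simp only [Set.mem_ofPred_eq, Set.mem_inter_iff, Set.mem_iInter]
    exact ⟨fun h => ⟨⟨⟨h.add, h.smul⟩, h.nonneg⟩, h.one⟩,
      fun h => ⟨h.1.1.1, h.1.1.2, h.1.2, h.2⟩⟩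
  rw [this]
  refine ((IsClosed.inter ?_ ?_).inter ?_).inter ?_
  · exact isClosed_iInter fun f => isClosed_iInter fun g =>
      isClosed_eq (continuous_apply _) (by fun_prop)
  · exact isClosed_iInter fun c => isClosed_iInter fun f =>
      isClosed_eq (continuous_apply _) (continuous_const.mul (continuous_apply _))
  · exact isClosed_iInter fun f => isClosed_iInter fun _ =>
      isClosed_le continuous_const (continuous_apply _)
  · exact isClosed_eq (continuous_apply _) continuous_const

/-- Tychonoff: the topology is pointwise convergence, and a mean takes its value at f in [-‖f‖,
‖f‖]. -/
theorem isCompact_setOf : IsCompact {m : BddFun G → ℝ | IsMean m} := by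
  refine (isCompact_univ_pi fun f : BddFun G => isCompact_Icc (a := -‖f‖)
    (b := ‖f‖)).of_isClosed_subset isClosed_setOf fun m hm f _ => ?_
  exact _root_.abs_le.1 (IsMean.abs_le hm f)

end IsMean

/-- Hahn–Banach for means: if no element of a convex set is bounded below by `c`, then some mean is
at most `c` on that set. -/
theorem exists_isMean_le {G : Type*} [Nonempty G] {S : Set (BddFun G)} (hS : Convex ℝ S) {c : ℝ}
    (h : ∀ f ∈ S, ∃ x, f x < c) : ∃ m : BddFun G → ℝ, IsMean m ∧ ∀ f ∈ S, m f ≤ c := by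
  obtain rfl | ⟨f₀, hf₀⟩ := S.eq_empty_or_nonempty
  · obtain ⟨x⟩ := ‹Nonempty G›
    exact ⟨_, IsMean.eval x, by simp⟩
  -- The uniform gap δ makes this set open, so it can be separated from S; the separating
  -- functional, normalised at 1, is the mean.
  let O : Set (BddFun G) := {f | ∃ δ > 0, ∀ x, c + δ ≤ f x}
  have hO : IsOpen O := by
    rw [Metric.isOpen_iff]
    rintro f ⟨δ, hδ, hf⟩
    refine ⟨δ / 2, half_pos hδ, fun g hg => ⟨δ / 2, half_pos hδ, fun x => ?_⟩⟩
    have h₁ := (g - f).abs_apply_le x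
    rw [Metric.mem_ball, dist_eq_norm] at hg
    have h₂ := (abs_le.1 h₁).1
    rw [BddFun.sub_apply] at h₂
    linarith [hf x]
  have hOc : Convex ℝ O := by
    rintro f ⟨δ, hδ, hf⟩ g ⟨η, hη, hg⟩ a b ha hb hab
    refine ⟨min δ η, lt_min hδ hη, fun x => ?_⟩
    have h₁ : c + min δ η ≤ f x := (by gcongr; exact min_le_left _ _ : _ ≤ c + δ).trans (hf x)
    have h₂ : c + min δ η ≤ g x := (by gcongr; exact min_le_right _ _ : _ ≤ c + η).trans (hg x)
    simp only [BddFun.add_apply, BddFun.smul_apply]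
    calc c + min δ η = a * (c + min δ η) + b * (c + min δ η) := by rw [← add_mul, hab, one_mul]
      _ ≤ _ := by gcongr
  have hdisj : Disjoint O S := by
    rw [Set.disjoint_left]
    rintro f ⟨δ, hδ, hf⟩ hfS
    obtain ⟨x, hx⟩ := h f hfS
    linarith [hf x]
  obtain ⟨φ', u', hφO', hφS'⟩ := geometric_hahn_banach_open hOc hO hS hdisj
  obtain ⟨φ, u, hφO, hφS⟩ : ∃ (φ : StrongDual ℝ (BddFun G)) (u : ℝ),
      (∀ f ∈ O, u < φ f) ∧ ∀ f ∈ S, φ f ≤ u :=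
    ⟨-φ', -u', fun f hf => by simpa using hφO' f hf, fun f hf => by simpa using hφS' f hf⟩
  -- O is stable under adding multiples n • f with f ≥ 0, while φ stays above u on O.
  have hnonneg (f : BddFun G) (hf : ∀ x, 0 ≤ f x) : 0 ≤ φ f := by
    by_contra! hneg
    obtain ⟨n, hn⟩ := exists_nat_gt ((φ ((c + 1) • 1) - u) / (-φ f))
    rw [div_lt_iff₀ (by linarith)] at hn
    have := hφO ((c + 1) • 1 + (n : ℝ) • f) ⟨1, one_pos, fun x => by
      simpa using mul_nonneg n.cast_nonneg (hf x)⟩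
    rw [map_add, map_smul φ (n : ℝ), smul_eq_mul] at this
    linarith
  -- If φ 1 = 0, positivity applied to ‖f‖ ± f kills φ, contradicting strict separation of O from
  -- `f₀`.
  have hone : 0 < φ 1 := by
    refine (hnonneg 1 fun x => by simp).lt_of_ne' fun h0 => ?_
    have hz (f : BddFun G) : φ f = 0 := by
      have h₁ := hnonneg (‖f‖ • 1 - f) fun x => by
        simpa using (abs_le.1 (f.abs_apply_le x)).2
      have h₂ := hnonneg (‖f‖ • 1 + f) fun x => by
        simpa using neg_le_iff_add_nonneg'.1 (abs_le.1 (f.abs_apply_le x)).1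
      rw [map_sub, map_smul, h0] at h₁
      rw [map_add, map_smul, h0] at h₂
      simp only [smul_zero] at h₁ h₂
      linarith
    have h₁ := hφO ((c + 1) • 1) ⟨1, one_pos, fun x => by simp⟩
    have h₂ := hφS f₀ hf₀
    rw [hz] at h₁ h₂
    linarith
  refine ⟨fun f => (φ 1)⁻¹ * φ f, ⟨fun f g => by rw [map_add]; ring,
    fun a f => by rw [map_smul, smul_eq_mul]; ring,
    fun f hf => mul_nonneg (inv_nonneg.2 hone.le) (hnonneg f hf),
    inv_mul_cancel₀ hone.ne'⟩, fun f hf => le_of_forall_pos_le_add fun δ hδ => ?_⟩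
  rw [inv_mul_le_iff₀ hone]
  have h₁ := hφO ((c + δ) • 1) ⟨δ, hδ, fun x => by simp⟩
  rw [map_smul, smul_eq_mul] at h₁
  linarith [hφS f hf]

/-! ### Convolution of means and minimal left ideals. -/

variable {G : Type*} [Group G]

/-- Translation `f ↦ f (s ·)` of bounded functions. -/
def BddFun.translate (s : G) (f : BddFun G) : BddFun G :=
  BddFun.mk (fun x => f (s * x)) ‖f‖ fun _ => f.abs_apply_le _

@[simp]
theorem BddFun.translate_apply (s : G) (f : BddFun G) (x : G) : f.translate s x = f (s * x) := rfl

@[simp]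
theorem BddFun.translate_one (f : BddFun G) : f.translate 1 = f := by
  ext x; simp

theorem BddFun.translate_translate (s t : G) (f : BddFun G) :
    (f.translate s).translate t = f.translate (s * t) := by
  ext x; simp [mul_assoc]

theorem BddFun.norm_translate_le (s : G) (f : BddFun G) : ‖f.translate s‖ ≤ ‖f‖ :=
  lp.norm_le_of_forall_le (norm_nonneg _) fun _ => f.abs_apply_le _

open Classical in
/-- The function `g ↦ k (f (g ·))`, for a mean `k`. -/
def poisson (k : BddFun G → ℝ) (f : BddFun G) : BddFun G :=
  if hk : IsMean k then
    BddFun.mk (fun g => k (f.translate g)) ‖f‖ fun g =>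
      (hk.abs_le _).trans (f.norm_translate_le g)
  else 0

theorem poisson_apply {k : BddFun G → ℝ} (hk : IsMean k) (f : BddFun G) (g : G) :
    poisson k f g = k (f.translate g) := by
  rw [poisson, dif_pos hk]; rfl

theorem translate_poisson {k : BddFun G → ℝ} (hk : IsMean k) (f : BddFun G) (s : G) :
    (poisson k f).translate s = poisson k (f.translate s) := by
  ext g
  rw [BddFun.translate_apply, poisson_apply hk, poisson_apply hk, BddFun.translate_translate]

/-- Convolution of means. -/
def conv (m k : BddFun G → ℝ) (f : BddFun G) : ℝ := m (poisson k f)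

theorem IsMean.conv {m k : BddFun G → ℝ} (hm : IsMean m) (hk : IsMean k) :
    IsMean (conv m k) where
  add f g := by
    have : poisson k (f + g) = poisson k f + poisson k g := by
      ext x
      rw [BddFun.add_apply]
      simp only [poisson_apply hk, ← hk.add]
      rfl
    rw [ReducedGroup.conv, this, hm.add]; rfl
  smul c f := by
    have : poisson k (c • f) = c • poisson k f := by
      ext x
      rw [BddFun.smul_apply]
      simp only [poisson_apply hk, ← hk.smul]
      rfl
    rw [ReducedGroup.conv, this, hm.smul]; rfl
  nonneg f hf := hm.nonneg _ fun x => by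
    rw [poisson_apply hk]
    exact hk.nonneg _ fun y => hf _
  one := by
    have : poisson k 1 = 1 := by
      ext x
      rw [poisson_apply hk, BddFun.one_apply, ← hk.one]
      congr 1
    rw [ReducedGroup.conv, this, hm.one]

/-- Associativity amounts to the Poisson transform commuting with translation. -/
theorem conv_assoc (m : BddFun G → ℝ) {c k : BddFun G → ℝ} (hc : IsMean c) (hk : IsMean k) :
    conv (conv m c) k = conv m (conv c k) := by
  funext f
  rw [conv, conv, conv]
  congr 1
  ext g
  rw [poisson_apply hc, poisson_apply (hc.conv hk), conv, translate_poisson hk]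

theorem conv_eval {k : BddFun G → ℝ} (hk : IsMean k) (s : G) (f : BddFun G) :
    conv (fun f => f s) k f = k (f.translate s) :=
  poisson_apply hk f s

/-- Nonempty closed convex left ideals of the semigroup of means. -/
structure IsMeanIdeal (K : Set (BddFun G → ℝ)) : Prop where
  nonempty : K.Nonempty
  isMean : ∀ k ∈ K, IsMean k
  closed : IsClosed K
  convex : Convex ℝ K
  conv_mem : ∀ m, IsMean m → ∀ k ∈ K, conv m k ∈ K

theorem IsMeanIdeal.isCompact {K : Set (BddFun G → ℝ)} (hK : IsMeanIdeal K) : IsCompact K :=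
  IsMean.isCompact_setOf.of_isClosed_subset hK.closed hK.isMean

theorem IsMeanIdeal.translate_mem {K : Set (BddFun G → ℝ)} (hK : IsMeanIdeal K)
    {k : BddFun G → ℝ} (hk : k ∈ K) (s : G) : (fun f => k (f.translate s)) ∈ K := by
  convert hK.conv_mem _ (IsMean.eval s) k hk using 1
  funext f
  exact (conv_eval (hK.isMean k hk) s f).symm

theorem isMeanIdeal_setOf : IsMeanIdeal {m : BddFun G → ℝ | IsMean m} :=
  ⟨⟨_, IsMean.eval 1⟩, fun _ h => h, IsMean.isClosed_setOf, IsMean.convex_setOf,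
    fun _ hm _ hk => hm.conv hk⟩

theorem exists_minimal_isMeanIdeal :
    ∃ K : Set (BddFun G → ℝ), Minimal IsMeanIdeal K := by
  suffices h : ∀ c ⊆ {K : Set (BddFun G → ℝ) | IsMeanIdeal K},
      IsChain (fun x y => x ⊆ y) c → c.Nonempty →
        ∃ lb ∈ {K : Set (BddFun G → ℝ) | IsMeanIdeal K}, ∀ K ∈ c, lb ⊆ K by
    obtain ⟨K, -, hK⟩ := zorn_superset_nonempty _ h _ isMeanIdeal_setOf
    exact ⟨K, hK⟩
  intro c hc hchain hne
  refine ⟨⋂₀ c, ⟨?_, ?_, isClosed_sInter fun K hK => (hc hK).closed,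
    convex_sInter fun K hK => (hc hK).convex, fun m hm k hk K hK =>
      (hc hK).conv_mem m hm k (hk K hK)⟩, fun K hK => Set.sInter_subset_of_mem hK⟩
  · have := hne.to_subtype
    exact IsCompact.nonempty_sInter_of_directed_nonempty_isCompact_isClosed
      (fun K hK L hL => (hchain.total hK hL).elim (fun h => ⟨K, hK, subset_rfl, h⟩)
        fun h => ⟨L, hL, h, subset_rfl⟩) (fun K hK => (hc hK).nonempty)
      (fun K hK => (hc hK).isCompact)
      fun K hK => (hc hK).closed
  · intro k hk
    obtain ⟨K, hK⟩ := hne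
    exact (hc hK).isMean k (hk K hK)

/-- Convolution is linear and pointwise continuous in its left variable, so the image of a compact
convex set is again compact and convex; continuity in the right variable is never needed. -/
theorem IsMeanIdeal.image_conv {C : Set (BddFun G → ℝ)} (hC : IsMeanIdeal C)
    {k : BddFun G → ℝ} (hk : IsMean k) : IsMeanIdeal ((fun c => conv c k) '' C) where
  nonempty := hC.nonempty.image _
  isMean := by
    rintro _ ⟨c, hc, rfl⟩
    exact (hC.isMean c hc).conv hk
  closed := (hC.isCompact.image (continuous_pi fun f => continuous_apply _)).isClosed
  convex := hC.convex.is_linear_image ⟨fun _ _ => rfl, fun _ _ => rfl⟩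
  conv_mem := by
    rintro m hm _ ⟨c, hc, rfl⟩
    exact ⟨conv m c, hC.conv_mem m hm c hc, conv_assoc m (hC.isMean c hc) hk⟩

/-- A minimal left ideal is contained in `C * k` for every ideal `C` and `k` in the minimal one. -/
theorem exists_conv_eq {K : Set (BddFun G → ℝ)} (hK : Minimal IsMeanIdeal K)
    {C : Set (BddFun G → ℝ)} (hC : IsMeanIdeal C) {k x : BddFun G → ℝ} (hk : k ∈ K) (hx : x ∈ K) :
    ∃ c ∈ C, conv c k = x := by
  have hsub : (fun c => conv c k) '' C ⊆ K := by
    rintro _ ⟨c, hc, rfl⟩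
    exact hK.prop.conv_mem c (hC.isMean c hc) k hk
  exact hK.le_of_le (hC.image_conv (hK.prop.isMean k hk)) hsub hx

/-- A mean representing an extreme point `x` is concentrated where the Poisson transform is close
to its value at `x`. -/
theorem mean_ind_eq_zero {K : Set (BddFun G → ℝ)} (hK : IsMeanIdeal K) {m k : BddFun G → ℝ}
    (hm : IsMean m) (hk : k ∈ K) (hx : conv m k ∈ Set.extremePoints ℝ K) {f : BddFun G} {b : ℝ}
    (hb : conv m k f < b) : m (BddFun.ind {g | b ≤ poisson k f g}) = 0 := by
  set B : Set G := {g | b ≤ poisson k f g} with hB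
  have hind0 (x : G) : 0 ≤ BddFun.ind B x := Set.indicator_nonneg (fun _ _ => zero_le_one) x
  have hind1 (x : G) : BddFun.ind B x ≤ 1 := Set.indicator_le_self' (fun _ _ => zero_le_one) x
  by_contra hne
  have hpos : 0 < m (BddFun.ind B) := (hm.nonneg _ hind0).lt_of_ne' hne
  -- The factor 1/2 keeps the mean of 1 - w positive even when B has full mean.
  let w : BddFun G := (1 / 2 : ℝ) • BddFun.ind B
  have hw : m w = (1 / 2) * m (BddFun.ind B) := hm.smul _ _
  have hwpos : 0 < m w := by rw [hw]; positivity
  have hwlt : m w ≤ 1 / 2 := hm.le_of_forall_le fun x => by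
    simp only [w, BddFun.smul_apply]; linarith [hind1 x]
  have hw0 (x : G) : 0 ≤ w x := by simpa [w] using hind0 x
  have hw1 (x : G) : 0 ≤ (1 - w) x := by
    simp only [w, BddFun.sub_apply, BddFun.smul_apply, BddFun.one_apply]; linarith [hind1 x]
  have hm1 : m (1 - w) = 1 - m w := by rw [hm.sub, hm.one]
  have hm1pos : 0 < m (1 - w) := by rw [hm1]; linarith
  have h₁ := hK.conv_mem _ (hm.weighted hw0 hwpos) k hk
  have h₂ := hK.conv_mem _ (hm.weighted hw1 hm1pos) k hk
  -- Splitting m by w and 1 - w splits the extreme point, so conditioning m on w does not change its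
  -- convolution with k. But w lives on B, where the transform is at least b.
  have hseg : conv m k ∈ openSegment ℝ (conv (fun f => (m w)⁻¹ * m (w * f)) k)
      (conv (fun f => (m (1 - w))⁻¹ * m ((1 - w) * f)) k) := by
    refine ⟨m w, m (1 - w), hwpos, hm1pos, by rw [hm1]; ring, ?_⟩
    funext f
    simp only [conv, Pi.add_apply, Pi.smul_apply, smul_eq_mul]
    rw [mul_inv_cancel_left₀ hwpos.ne', mul_inv_cancel_left₀ hm1pos.ne', ← hm.add, ← add_mul,
      add_sub_cancel, one_mul]
  have heq := congrFun (hx.2 h₁ h₂ hseg) f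
  have hge : b * m w ≤ m (w * poisson k f) := by
    rw [← hm.smul]
    refine hm.mono fun x => ?_
    simp only [BddFun.smul_apply, BddFun.mul_apply]
    by_cases hxB : x ∈ B
    · rw [mul_comm]
      exact mul_le_mul_of_nonneg_left hxB (hw0 x)
    · simp [w, BddFun.ind_apply, hxB]
  rw [conv, inv_mul_eq_iff_eq_mul₀ hwpos.ne'] at heq
  rw [heq, mul_comm] at hge
  exact absurd (le_of_mul_le_mul_left hge hwpos) (not_le.2 hb)

/-- The elements of `G` acting trivially on a set of means. -/
def fixator {K : Set (BddFun G → ℝ)} (_hK : IsMeanIdeal K) : Subgroup G where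
  carrier := {n | ∀ k ∈ K, ∀ f, k (f.translate n) = k f}
  one_mem' k _ f := by rw [BddFun.translate_one]
  mul_mem' {a b} ha hb k hk f := by
    rw [← BddFun.translate_translate, hb k hk, ha k hk]
  inv_mem' {a} ha k hk f := by
    rw [← ha k hk, BddFun.translate_translate, inv_mul_cancel, BddFun.translate_one]

theorem mem_fixator {K : Set (BddFun G → ℝ)} {hK : IsMeanIdeal K} {n : G} :
    n ∈ fixator hK ↔ ∀ k ∈ K, ∀ f, k (f.translate n) = k f := Iff.rfl

instance {K : Set (BddFun G → ℝ)} (hK : IsMeanIdeal K) : (fixator hK).Normal where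
  conj_mem n hn s k hk f := by
    have := hn _ (hK.translate_mem hk s⁻¹) (f.translate s)
    simpa only [BddFun.translate_translate, mul_inv_cancel, BddFun.translate_one] using this

/-- An element acting nontrivially on a minimal ideal moves a set `A` off itself, where a convex
combination of translates of the indicator of `A` is uniformly close to `1`. -/
theorem exists_displaced_set {K : Set (BddFun G → ℝ)} (hK : Minimal IsMeanIdeal K) {t : G}
    (ht : t ∉ fixator hK.prop) :
    ∃ A : Set G, (∀ g ∈ A, t * g ∉ A) ∧ ∀ ε : ℝ, 0 < ε →
      ∃ f ∈ convexHull ℝ (Set.range fun s : G => (BddFun.ind A).translate s),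
        ∀ x, 1 - ε ≤ f x := by
  -- Krein–Milman: otherwise the reverse inequality spreads from the extreme points to K, and
  -- replacing f by -f turns it into invariance under t.
  obtain ⟨x, hx, f, hxf⟩ : ∃ x ∈ Set.extremePoints ℝ K, ∃ f, x (f.translate t) < x f := by
    by_contra! hall
    refine ht fun k hk f => ?_
    have hfix (f : BddFun G) : k f ≤ k (f.translate t) := by
      have hsub : closure (convexHull ℝ (Set.extremePoints ℝ K)) ⊆
          {k | k f ≤ k (f.translate t)} := by
        refine closure_minimal (convexHull_min (fun x hx => hall x hx f) ?_)
          (isClosed_le (continuous_apply _) (continuous_apply _))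
        intro m hm k hk a b ha hb _
        have hm : m f ≤ m (f.translate t) := hm
        have hk : k f ≤ k (f.translate t) := hk
        simp only [Set.mem_ofPred_eq, Pi.add_apply, Pi.smul_apply, smul_eq_mul]
        gcongr
      rw [closure_convexHull_extremePoints hK.prop.isCompact hK.prop.convex] at hsub
      exact hsub hk
    refine le_antisymm ?_ (hfix f)
    have := hfix (-f)
    have hneg : (-f).translate t = -f.translate t := by
      ext x; simp
    rw [hneg, (hK.prop.isMean k hk).neg, (hK.prop.isMean k hk).neg] at this
    linarith
  obtain ⟨k, hk⟩ := hK.prop.nonempty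
  have hkm := hK.prop.isMean k hk
  obtain ⟨a, ha₁, ha₂⟩ := exists_between hxf
  -- The second transform at g is the first at t * g, so g and t * g cannot both lie in A.
  let A : Set G := {g | a < poisson k f g ∧ poisson k (f.translate t) g < a}
  refine ⟨A, fun g hg hg' => ?_, fun ε hε => ?_⟩
  · have h₁ : a < poisson k f (t * g) := hg'.1
    rw [← BddFun.translate_apply, translate_poisson hkm] at h₁
    exact lt_asymm h₁ hg.2
  by_contra! hcon
  obtain ⟨m₀, hm₀, hm₀'⟩ := exists_isMean_le (convex_convexHull ℝ _) hcon
  -- Requiring the bound at every translate makes C a left ideal. By minimality some m in C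
  -- represents x over k; extremality of x then forces m to give A full mean, against the bound at s
  -- = 1.
  let C : Set (BddFun G → ℝ) :=
    {m | IsMean m ∧ ∀ s, m ((BddFun.ind A).translate s) ≤ 1 - ε}
  have hC : IsMeanIdeal C := by
    refine ⟨⟨m₀, hm₀, fun s => hm₀' _ (subset_convexHull _ _ ⟨s, rfl⟩)⟩, fun _ h => h.1, ?_, ?_, ?_⟩
    · have : C = {m | IsMean m} ∩ ⋂ s, {m | m ((BddFun.ind A).translate s) ≤ 1 - ε} := by
        ext m
        simp only [C, Set.mem_inter_iff, Set.mem_iInter, Set.mem_ofPred_eq]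
      rw [this]
      exact IsMean.isClosed_setOf.inter
        (isClosed_iInter fun s => isClosed_le (continuous_apply _) continuous_const)
    · refine IsMean.convex_setOf.inter fun m hm k hk a b ha hb hab s => ?_
      simp only [Pi.add_apply, Pi.smul_apply, smul_eq_mul]
      calc _ ≤ a * (1 - ε) + b * (1 - ε) := by
            gcongr
            exacts [hm s, hk s]
        _ = 1 - ε := by rw [← add_mul, hab, one_mul]
    · refine fun m hm k hk => ⟨hm.conv hk.1, fun s => hm.le_of_forall_le fun g => ?_⟩
      rw [poisson_apply hk.1, BddFun.translate_translate]
      exact hk.2 _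
  obtain ⟨m, ⟨hm, hmA⟩, hmx⟩ := exists_conv_eq hK hC hk hx.1
  rw [← hmx] at hx ha₁ ha₂
  have h₁ := mean_ind_eq_zero hK.prop hm hk hx ha₁
  have h₂ := mean_ind_eq_zero hK.prop hm hk hx (f := -f) (b := -a) (by
    rw [(hm.conv hkm).neg]; linarith)
  have hcover : m 1 ≤ m (BddFun.ind A + (BddFun.ind {g | a ≤ poisson k (f.translate t) g} +
      BddFun.ind {g | -a ≤ poisson k (-f) g})) := by
    refine hm.mono fun g => ?_
    have hneg : poisson k (-f) g = -poisson k f g := by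
      rw [poisson_apply hkm, poisson_apply hkm, ← hkm.neg]
      rfl
    simp only [BddFun.add_apply, BddFun.one_apply, BddFun.ind_apply]
    have hi (D : Set G) : 0 ≤ D.indicator (1 : G → ℝ) g :=
      Set.indicator_nonneg (fun _ _ => zero_le_one) g
    by_cases hg₁ : a ≤ poisson k (f.translate t) g
    · rw [Set.indicator_of_mem (s := {g | a ≤ poisson k (f.translate t) g}) hg₁]
      simp only [Pi.one_apply]
      linarith [hi A, hi {g | -a ≤ poisson k (-f) g}]
    by_cases hg₂ : -a ≤ poisson k (-f) g
    · rw [Set.indicator_of_mem (s := {g | -a ≤ poisson k (-f) g}) hg₂]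
      simp only [Pi.one_apply]
      linarith [hi A, hi {g | a ≤ poisson k (f.translate t) g}]
    · have hgA : g ∈ A := ⟨by rw [hneg] at hg₂; linarith, not_le.1 hg₁⟩
      rw [Set.indicator_of_mem hgA]
      simp only [Pi.one_apply]
      linarith [hi {g | -a ≤ poisson k (-f) g}, hi {g | a ≤ poisson k (f.translate t) g}]
  rw [hm.one, hm.add, hm.add, h₁, h₂] at hcover
  have := hmA 1
  rw [BddFun.translate_one] at this
  linarith

end Mean

/-! ### From displaced sets to small averages of conjugates. -/

section Averaging

variable {G : Type*} [Group G]

theorem summable_norm_sq {G : Type*} (ξ : ℓ²(G, ℂ)) : Summable fun x => ‖ξ x‖ ^ 2 := by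
  simpa using (lp.memℓp ξ).summable (by norm_num)

theorem norm_sq_eq_tsum {G : Type*} (ξ : ℓ²(G, ℂ)) : ‖ξ‖ ^ 2 = ∑' x, ‖ξ x‖ ^ 2 := by
  simpa using lp.norm_rpow_eq_tsum (p := 2) (by norm_num) ξ

theorem summable_weighted {G : Type*} (f : BddFun G) (ξ : ℓ²(G, ℂ)) :
    Summable fun x => (1 - f x) * ‖ξ x‖ ^ 2 := by
  refine Summable.of_norm_bounded ((summable_norm_sq ξ).mul_left ‖1 - f‖) fun x => ?_
  rw [norm_mul, norm_pow, norm_norm]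
  gcongr
  simpa using (1 - f).abs_apply_le x

/-- Test against η = Tξ/‖Tξ‖. Sums of squares are used because such bounds pass to convex
combinations. -/
theorem norm_le_of_forall_inner_le {H : Type*} [NormedAddCommGroup H] [InnerProductSpace ℂ H]
    (T : H →L[ℂ] H) {r : ℝ} (hr : 0 ≤ r)
    (h : ∀ ξ η : H, ‖(inner ℂ η (T ξ) : ℂ)‖ ≤ r * (‖η‖ ^ 2 + ‖ξ‖ ^ 2)) : ‖T‖ ≤ 2 * r := by
  refine ContinuousLinearMap.opNorm_le_of_unit_norm (by positivity) fun ξ hξ => ?_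
  by_cases h0 : ‖T ξ‖ = 0
  · rw [h0]; positivity
  have h₁ := h ξ (((‖T ξ‖⁻¹ : ℝ) : ℂ) • T ξ)
  rw [inner_smul_left, norm_mul, norm_smul, inner_self_eq_norm_sq_to_K, hξ] at h₁
  simp only [RCLike.norm_conj, Complex.norm_real, norm_inv, norm_norm, norm_pow,
    Complex.coe_algebraMap] at h₁
  rw [inv_mul_cancel₀ h0, pow_two, inv_mul_cancel_left₀ h0] at h₁
  linarith

/-- If `t` moves `A` off itself, matrix coefficients of `λ(s⁻¹ t s)` are small at vectors
concentrated on `s⁻¹ A`. -/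
theorem norm_inner_lam_le {A : Set G} {t : G} (hA : ∀ g ∈ A, t * g ∉ A) (s : G) {r : ℝ}
    (hr : 0 < r) (ξ η : ℓ²(G, ℂ)) :
    ‖inner ℂ η ((lam (s⁻¹ * t * s) : ℓ²(G, ℂ) →L[ℂ] ℓ²(G, ℂ)) ξ)‖ ≤
      (1 / (2 * r)) * (∑' x, (1 - (BddFun.ind A).translate s x) * ‖η x‖ ^ 2 +
        ∑' x, (1 - (BddFun.ind A).translate s x) * ‖ξ x‖ ^ 2) +
      (r / 2) * (‖η‖ ^ 2 + ‖ξ‖ ^ 2) := by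
  set f := (BddFun.ind A).translate s with hf
  set e := Equiv.mulLeft (s⁻¹ * t * s)⁻¹ with he
  have hf1 (x : G) : f x ≤ 1 := Set.indicator_le_self' (fun _ _ => zero_le_one) _
  -- The points s * x and s * e x differ by t, so at most one lies in A.
  have hfe (x : G) : 1 ≤ 1 - f x ∨ 1 ≤ 1 - f (e x) := by
    by_cases hx : s * e x ∈ A
    · have h₁ := hA _ hx
      have h₂ : t * (s * e x) = s * x := by simp [he, mul_assoc]
      rw [h₂] at h₁
      have : f x = 0 := Set.indicator_of_notMem h₁ _
      left; linarith
    · have : f (e x) = 0 := Set.indicator_of_notMem hx _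
      right; linarith
  have amgm (a b : ℝ) : a * b ≤ (1 / (2 * r)) * a ^ 2 + (r / 2) * b ^ 2 := by
    have h₁ : (1 / (2 * r)) * a ^ 2 + (r / 2) * b ^ 2 - a * b = (a - r * b) ^ 2 / (2 * r) := by
      field_simp
      ring
    have h₂ : 0 ≤ (a - r * b) ^ 2 / (2 * r) := by positivity
    linarith
  -- The large coefficient 1/(2r) is charged to the factor whose weight is at least 1, which
  -- averaging later makes small.
  have key (a b p q : ℝ) (hp : 0 ≤ p) (hq : 0 ≤ q) (hpq : 1 ≤ p ∨ 1 ≤ q) :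
      a * b ≤ (1 / (2 * r)) * (p * a ^ 2 + q * b ^ 2) + (r / 2) * (a ^ 2 + b ^ 2) := by
    rcases hpq with hp1 | hq1
    · calc a * b ≤ (1 / (2 * r)) * (1 * a ^ 2 + 0) + (r / 2) * (0 + b ^ 2) := by
            linarith [amgm a b]
        _ ≤ _ := by gcongr <;> positivity
    · calc a * b ≤ (1 / (2 * r)) * (0 + 1 * b ^ 2) + (r / 2) * (a ^ 2 + 0) := by
            linarith [amgm b a]
        _ ≤ _ := by gcongr <;> positivity
  rw [lp.inner_eq_tsum, norm_sq_eq_tsum η, norm_sq_eq_tsum ξ]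
  refine tsum_of_norm_bounded
    (((((summable_weighted f η).hasSum.add (e.hasSum_iff.2 (summable_weighted f ξ).hasSum)).mul_left
      (1 / (2 * r)))).add (((summable_norm_sq η).hasSum.add
        (e.hasSum_iff.2 (summable_norm_sq ξ).hasSum)).mul_left (r / 2))) fun x => ?_
  refine (norm_inner_le_norm _ _).trans ?_
  exact key _ _ _ _ (by linarith [hf1 x]) (by linarith [hf1 (e x)]) (hfe x)

/-- Averages of translates of the indicator of a displaced set yield averages of conjugates. -/
theorem exists_average_le {A : Set G} {t : G} (hA : ∀ g ∈ A, t * g ∉ A) {r : ℝ} (hr : 0 < r)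
    {f : BddFun G} (hf : f ∈ convexHull ℝ (Set.range fun s : G => (BddFun.ind A).translate s)) :
    ∃ T ∈ convexHull ℝ (Set.range fun s : G => lam (s * t * s⁻¹)), ∀ ξ η : ℓ²(G, ℂ),
      ‖inner ℂ η ((T : ℓ²(G, ℂ) →L[ℂ] ℓ²(G, ℂ)) ξ)‖ ≤
        (1 / (2 * r)) * (∑' x, (1 - f x) * ‖η x‖ ^ 2 + ∑' x, (1 - f x) * ‖ξ x‖ ^ 2) +
        (r / 2) * (‖η‖ ^ 2 + ‖ξ‖ ^ 2) := by
  -- For fixed r the bound is affine in f, so the functions admitting such a T form a convex set.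
  refine convexHull_min (t := {f : BddFun G |
    ∃ T ∈ convexHull ℝ (Set.range fun s : G => lam (s * t * s⁻¹)), ∀ ξ η : ℓ²(G, ℂ),
      ‖inner ℂ η ((T : ℓ²(G, ℂ) →L[ℂ] ℓ²(G, ℂ)) ξ)‖ ≤
        (1 / (2 * r)) * (∑' x, (1 - f x) * ‖η x‖ ^ 2 + ∑' x, (1 - f x) * ‖ξ x‖ ^ 2) +
        (r / 2) * (‖η‖ ^ 2 + ‖ξ‖ ^ 2)}) ?_ ?_ hf
  · rintro _ ⟨s, rfl⟩
    refine ⟨lam (s⁻¹ * t * s), subset_convexHull _ _ ⟨s⁻¹, by simp⟩, fun ξ η => ?_⟩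
    exact norm_inner_lam_le hA s hr ξ η
  · rintro f ⟨T, hT, hTf⟩ g ⟨S, hS, hSg⟩ a b ha hb hab
    refine ⟨a • T + b • S, convex_convexHull ℝ _ hT hS ha hb hab, fun ξ η => ?_⟩
    have hsum (ζ : ℓ²(G, ℂ)) : ∑' x, (1 - (a • f + b • g) x) * ‖ζ x‖ ^ 2 =
        a * ∑' x, (1 - f x) * ‖ζ x‖ ^ 2 + b * ∑' x, (1 - g x) * ‖ζ x‖ ^ 2 := by
      rw [← tsum_mul_left, ← tsum_mul_left, ← Summable.tsum_add
        ((summable_weighted f ζ).mul_left a) ((summable_weighted g ζ).mul_left b)]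
      refine tsum_congr fun x => ?_
      simp only [BddFun.add_apply, BddFun.smul_apply]
      linear_combination (-‖ζ x‖ ^ 2) * hab
    have hT' : ((a • T + b • S : reducedCStar G) : ℓ²(G, ℂ) →L[ℂ] ℓ²(G, ℂ)) ξ =
        (a : ℂ) • (T : ℓ²(G, ℂ) →L[ℂ] ℓ²(G, ℂ)) ξ +
          (b : ℂ) • (S : ℓ²(G, ℂ) →L[ℂ] ℓ²(G, ℂ)) ξ := rfl
    rw [hsum, hsum, hT', inner_add_right, inner_smul_right, inner_smul_right]
    refine (norm_add_le _ _).trans ?_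
    rw [norm_mul, norm_mul, Complex.norm_real, Complex.norm_real, Real.norm_of_nonneg ha,
      Real.norm_of_nonneg hb]
    have h₁ := mul_le_mul_of_nonneg_left (hTf ξ η) ha
    have h₂ := mul_le_mul_of_nonneg_left (hSg ξ η) hb
    refine (add_le_add h₁ h₂).trans_eq ?_
    linear_combination (r / 2) * (‖η‖ ^ 2 + ‖ξ‖ ^ 2) * hab

theorem zero_mem_closure_of_displaced {A : Set G} {t : G} (hA : ∀ g ∈ A, t * g ∉ A)
    (h : ∀ ε : ℝ, 0 < ε → ∃ f ∈ convexHull ℝ (Set.range fun s : G => (BddFun.ind A).translate s),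
      ∀ x, 1 - ε ≤ f x) :
    (0 : reducedCStar G) ∈ closure (convexHull ℝ (Set.range fun s : G => lam (s * t * s⁻¹))) := by
  rw [Metric.mem_closure_iff]
  intro ε hε
  have hr : 0 < ε / 4 := by positivity
  -- With r = ε/4 and tolerance r², the coefficient is r²/(2r) + r/2 = r, so the norm is at most 2r
  -- = ε/2.
  obtain ⟨f, hf, hfr⟩ := h ((ε / 4) ^ 2) (by positivity)
  obtain ⟨T, hT, hTf⟩ := exists_average_le hA hr hf
  refine ⟨T, hT, ?_⟩
  set r := ε / 4 with hrdef
  have hsum (ζ : ℓ²(G, ℂ)) : ∑' x, (1 - f x) * ‖ζ x‖ ^ 2 ≤ r ^ 2 * ‖ζ‖ ^ 2 := by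
    rw [norm_sq_eq_tsum, ← tsum_mul_left]
    refine Summable.tsum_le_tsum (fun x => ?_) (summable_weighted f ζ)
      ((summable_norm_sq ζ).mul_left _)
    gcongr
    linarith [hfr x]
  have hT2 : ‖(T : ℓ²(G, ℂ) →L[ℂ] ℓ²(G, ℂ))‖ ≤ 2 * r := by
    refine norm_le_of_forall_inner_le _ hr.le fun ξ η => (hTf ξ η).trans ?_
    calc _ ≤ (1 / (2 * r)) * (r ^ 2 * ‖η‖ ^ 2 + r ^ 2 * ‖ξ‖ ^ 2) +
          (r / 2) * (‖η‖ ^ 2 + ‖ξ‖ ^ 2) := by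
            gcongr
            exacts [hsum η, hsum ξ]
      _ = r * (‖η‖ ^ 2 + ‖ξ‖ ^ 2) := by
        field_simp
        ring
  rw [dist_comm, dist_zero_right]
  calc ‖T‖ = ‖(T : ℓ²(G, ℂ) →L[ℂ] ℓ²(G, ℂ))‖ := rfl
    _ ≤ 2 * r := hT2
    _ < ε := by rw [hrdef]; linarith

end Averaging

/-! ### Invariant means and amenability of the fixator. -/

section Amenable

variable {G : Type*} [Group G]

/-- Divide by a coset representative; normality keeps the coset fixed under left multiplication by
N. The map lets a mean on G produce densities supported on N. -/
theorem exists_equivariant_projection (N : Subgroup G) [N.Normal] :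
    ∃ p : G → G, (∀ x, p x ∈ N) ∧ ∀ n ∈ N, ∀ x, p (n * x) = n * p x := by
  refine ⟨fun x => x * ((x : G ⧸ N).out)⁻¹, fun x => ?_, fun n hn x => ?_⟩
  · rw [← QuotientGroup.eq_one_iff, QuotientGroup.mk_mul, QuotientGroup.mk_inv,
      QuotientGroup.out_eq', mul_inv_cancel]
  · have : ((n * x : G) : G ⧸ N) = x := by
      rw [QuotientGroup.mk_mul, (QuotientGroup.eq_one_iff n).2 hn, one_mul]
    simp only [this, mul_assoc]

open Classical in
/-- Day's convexity argument: an `N`-invariant mean yields almost `N`-invariant probability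
densities on `N`. -/
theorem exists_almost_invariant_density {N : Subgroup G} [N.Normal] {m : BddFun G → ℝ}
    (hm : IsMean m) (hinv : ∀ n ∈ N, ∀ f : BddFun G, m (f.translate n) = m f)
    (F : Finset G) (hF : ∀ n ∈ F, n ∈ N) {ε : ℝ} (hε : 0 < ε) :
    ∃ f : G → ℝ, (∀ x, 0 ≤ f x) ∧ HasSum f 1 ∧ (∀ x, x ∉ N → f x = 0) ∧
      ∀ n ∈ F, ∑' x, |f (n⁻¹ * x) - f x| ≤ ε := by
  obtain ⟨p, hpN, hp⟩ := exists_equivariant_projection N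
  let δ : G → lp (fun _ : G => ℝ) 1 := fun x => lp.single 1 x (1 : ℝ)
  let T : G → (F → lp (fun _ : G => ℝ) 1) := fun x n => δ (n * p x) - δ (p x)
  -- A separating φ would make φ ∘ T bounded below by a positive constant, but φ ∘ T is a sum of
  -- differences of N-translates, which m kills.
  have hzero : (0 : F → lp (fun _ : G => ℝ) 1) ∈ closure (convexHull ℝ (Set.range T)) := by
    by_contra hnot
    obtain ⟨φ, u, h0, hu⟩ := geometric_hahn_banach_point_closed
      (convex_convexHull ℝ (Set.range T)).closure isClosed_closure hnot
    rw [map_zero] at h0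
    let h (n : F) : BddFun G := BddFun.mk (fun x => φ (Pi.single n (δ (p x)))) ‖φ‖ fun x => by
      have hle := φ.le_opNorm (Pi.single n (δ (p x)))
      have h1 : ‖(Pi.single n (δ (p x)) : F → lp (fun _ : G => ℝ) 1)‖ ≤ 1 := by
        rw [Pi.norm_single]
        simp [δ, lp.norm_single]
      exact hle.trans (mul_le_of_le_one_right (norm_nonneg _) h1)
    have hφT (x : G) : φ (T x) = (∑ n : F, ((h n).translate (n : G) - h n)) x := by
      have h1 : T x = ∑ n : F, (Pi.single n (δ (p (n * x))) - Pi.single n (δ (p x))) := by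
        rw [← Finset.univ_sum_single (T x)]
        refine Finset.sum_congr rfl fun n _ => ?_
        rw [← Pi.single_sub, hp n (hF n n.2)]
      rw [h1, map_sum, lp.coeFn_sum, Finset.sum_apply]
      refine Finset.sum_congr rfl fun n _ => ?_
      rw [map_sub]
      rfl
    have hsum : m (∑ n : F, ((h n).translate (n : G) - h n)) = 0 := by
      change AddMonoidHom.mk' m hm.add _ = 0
      rw [map_sum]
      refine Finset.sum_eq_zero fun n _ => ?_
      change m _ = 0
      rw [hm.sub, hinv n (hF n n.2), sub_self]
    have hge : u ≤ m (∑ n : F, ((h n).translate (n : G) - h n)) := hm.le_of_forall_ge fun x => by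
      rw [← hφT]
      exact (hu _ (subset_closure (subset_convexHull _ _ ⟨x, rfl⟩))).le
    linarith
  obtain ⟨v, hv, hvε⟩ := Metric.mem_closure_iff.1 hzero ε hε
  -- Working in the product over F ensures that one density f serves all n simultaneously.
  have hconv : v ∈ {v : F → lp (fun _ : G => ℝ) 1 | ∃ f : G → ℝ, (∀ x, 0 ≤ f x) ∧ HasSum f 1 ∧
      (∀ x, x ∉ N → f x = 0) ∧ ∀ (n : F) (x : G), v n x = f ((n : G)⁻¹ * x) - f x} := by
    refine convexHull_min ?_ ?_ hv
    · rintro _ ⟨x, rfl⟩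
      refine ⟨Pi.single (p x) 1, fun y => ?_, hasSum_pi_single _ _, fun y hy => ?_,
        fun n y => ?_⟩
      · exact (Pi.single_nonneg.2 zero_le_one : (0 : G → ℝ) ≤ Pi.single (p x) 1) y
      · exact Pi.single_eq_of_ne (fun h : y = p x => hy (by rw [h]; exact hpN x)) _
      · change (δ (n * p x) : G → ℝ) y - (δ (p x) : G → ℝ) y = _
        simp only [δ, lp.single_apply, Pi.single_apply, inv_mul_eq_iff_eq_mul]
    · rintro v ⟨f, hf0, hf1, hfN, hfv⟩ w ⟨g, hg0, hg1, hgN, hgw⟩ a b ha hb hab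
      refine ⟨fun x => a * f x + b * g x, fun x => ?_, ?_, fun x hx => ?_, fun n x => ?_⟩
      · exact add_nonneg (mul_nonneg ha (hf0 x)) (mul_nonneg hb (hg0 x))
      · simpa [hab] using (hf1.mul_left a).add (hg1.mul_left b)
      · simp [hfN x hx, hgN x hx]
      · change a * v n x + b * w n x = _
        rw [hfv, hgw]
        ring
  obtain ⟨f, hf0, hf1, hfN, hfv⟩ := hconv
  refine ⟨f, hf0, hf1, hfN, fun n hn => ?_⟩
  have h1 : ‖v ⟨n, hn⟩‖ = ∑' x, |f (n⁻¹ * x) - f x| := by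
    have := lp.norm_rpow_eq_tsum (p := 1) (by norm_num) (v ⟨n, hn⟩)
    simpa [hfv] using this
  rw [← h1]
  rw [dist_comm, dist_zero_right] at hvε
  exact (norm_le_pi_norm v _).trans hvε.le

/-- Take square roots of the densities: |√a - √b|² ≤ |a - b| turns an ℓ¹ estimate ε² into an ℓ²
estimate ε. -/
theorem hasAlmostInvariantVectors_of_mean {N : Subgroup G} [N.Normal] {m : BddFun G → ℝ}
    (hm : IsMean m) (hinv : ∀ n ∈ N, ∀ f : BddFun G, m (f.translate n) = m f) :
    HasAlmostInvariantVectors N := by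
  intro F hF ε hε
  obtain ⟨f, hf0, hf1, hfN, hfF⟩ :=
    exists_almost_invariant_density hm hinv F hF (ε := ε ^ 2) (by positivity)
  have hsq (x : G) : ‖((√(f x) : ℝ) : ℂ)‖ ^ 2 = f x := by
    rw [Complex.norm_real, Real.norm_of_nonneg (Real.sqrt_nonneg _), Real.sq_sqrt (hf0 x)]
  let ξ : ℓ²(G, ℂ) := ⟨fun x => ((√(f x) : ℝ) : ℂ), memℓp_gen (by
    have : Summable fun x => ‖((√(f x) : ℝ) : ℂ)‖ ^ 2 := by simpa only [hsq] using hf1.summable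
    simpa using this)⟩
  have hξ (x : G) : ξ x = ((√(f x) : ℝ) : ℂ) := rfl
  refine ⟨ξ, ?_, fun x hx => by rw [hξ, hfN x hx]; simp, fun n hn => ?_⟩
  · rw [← sq_eq_sq₀ (norm_nonneg _) zero_le_one, norm_sq_eq_tsum]
    simp only [hξ, hsq, hf1.tsum_eq, one_pow]
  · rw [← sq_le_sq₀ (norm_nonneg _) hε.le]
    refine le_trans ?_ (hfF n hn)
    rw [norm_sq_eq_tsum]
    have hsumm : Summable fun x => |f (n⁻¹ * x) - f x| :=
      (((Equiv.mulLeft n⁻¹).summable_iff.2 hf1.summable).sub hf1.summable).abs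
    refine Summable.tsum_le_tsum (fun x => ?_) (summable_norm_sq _) hsumm
    change ‖ξ (n⁻¹ * x) - ξ x‖ ^ 2 ≤ _
    rw [hξ, hξ, ← Complex.ofReal_sub, Complex.norm_real, Real.norm_eq_abs]
    set a := f (n⁻¹ * x)
    set b := f x
    calc |√a - √b| ^ 2 = |√a - √b| * |√a - √b| := sq _
      _ ≤ |√a - √b| * |√a + √b| := by
        refine mul_le_mul_of_nonneg_left ?_ (abs_nonneg _)
        rw [abs_of_nonneg (add_nonneg (Real.sqrt_nonneg a) (Real.sqrt_nonneg b)), abs_le]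
        constructor <;> linarith [Real.sqrt_nonneg a, Real.sqrt_nonneg b]
      _ = |a - b| := by
        rw [← abs_mul]
        congr 1
        linear_combination Real.sq_sqrt (hf0 (n⁻¹ * x)) - Real.sq_sqrt (hf0 x)

theorem zero_mem_closure_of_existsUnique
    (h : ∃! τ : reducedCStar G →L[ℂ] ℂ, IsTracialState τ) {t : G} (ht : t ≠ 1) :
    (0 : reducedCStar G) ∈ closure (convexHull ℝ (Set.range fun s : G => lam (s * t * s⁻¹))) := by
  obtain ⟨K, hK⟩ := exists_minimal_isMeanIdeal (G := G)
  obtain ⟨k, hk⟩ := hK.prop.nonempty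
  have hbot : fixator hK.prop = ⊥ := eq_bot_of_hasAlmostInvariantVectors h
    (hasAlmostInvariantVectors_of_mean (hK.prop.isMean k hk)
      fun n hn f => mem_fixator.1 hn k hk f)
  obtain ⟨A, hA, hconv⟩ := exists_displaced_set hK (t := t) (by rwa [hbot, Subgroup.mem_bot])
  exact zero_mem_closure_of_displaced hA hconv

end Amenable

end ReducedGroup

end

theorem corollary4p4 {G : Type*} [Group G] :
    (∃! τ : ReducedGroup.reducedCStar G →L[ℂ] ℂ, ReducedGroup.IsTracialState τ) ↔
      ∀ t : G, t ≠ 1 →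
        (0 : ReducedGroup.reducedCStar G) ∈
          closure (convexHull ℝ
            (Set.range fun s : G => ReducedGroup.lam (s * t * s⁻¹))) :=
  ⟨fun h _ ht => ReducedGroup.zero_mem_closure_of_existsUnique h ht,
    ReducedGroup.existsUnique_isTracialState⟩
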